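/- Let $M^4_q(G)$ be a 4-dimensional semi-Riemannian manifold of index $q\in\{1,2\}$ and constant sectional curvature $G$, with metric $\langle\cdot,\cdot\rangle$ and Levi-Civita connection $\nabla$. Fix $a>0$, and let $\gamma$ be a null curve in $M^4_q(G)$, defined on an open interval, parametrized by the pseudo arc-length parameter $\sigma$ normalized by $a$, with Cartan frame $T=\gamma',W_1,N,W_2$ and curvatures $k_1,k_2$. That is, $\langle T,T\rangle=\langle N,N\rangle=0$, $\langle T,N\rangle=-1$, $\langle W_i,T\rangle=\langle W_i,N\rangle=\langle W_1,W_2\rangle=0$, $\langle W_i,W_i\rangle=\varepsilon_i=\pm1$ and $$\nabla_TT=aW_1,\quad \nabla_TW_1=-k_1T+a\varepsilon_1N,\quad \nabla_TN=-\varepsilon_1k_1W_1+\varepsilon_2k_2W_2,\quad \nabla_TW_2=k_2T.$$ Let $\mathcal P=\mathbb R[k_1^{(m)},k_2^{(n)}:m,n\in\mathbb N]$ be the differential algebra of polynomials in the indeterminates $k_i^{(m)}$, with derivation $f\mapsto f'$, $(k_i^{(m)})'=k_i^{(m+1)}$. Let $\mathfrak X_{\mathcal P}(\gamma)$ be the set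 of $\mathcal P$-local vector fields $V=f_VT+h_VW_1+g_VN+l_VW_2$ with $f_V,h_V,g_V,l_V\in\mathcal P$; the scalar product and $\nabla_T$ act on it through the relations above. Put $$\varphi_V=\varepsilon_1\langle\nabla_TV,W_1\rangle,\quad \psi_V=\varepsilon_2\langle\nabla_TV,W_2\rangle,\quad \rho_V=-\varepsilon_1\langle\nabla_T^2V,W_1\rangle,\quad \alpha_V=\tfrac1a\bigl(\varphi_V'+\tfrac12\rho_V\bigr),$$ $$\beta_V=\tfrac1a(\alpha_V'+k_1\varphi_V-k_2\psi_V-Gg_V),\qquad \delta_V=\tfrac1a\psi_V''+k_1\psi_V+\varepsilon_1\varepsilon_2k_2\varphi_V,$$ and let $\mathfrak X^*_{\mathcal P}(\gamma)=\{V\in\mathfrak X_{\mathcal P}(\gamma):\langle\nabla_TV,T\rangle=0\}$ (the fields locally preserving the causal character) and $T_{\mathcal P,\gamma}(\Lambda)=\{V\in\mathfrak X^*_{\mathcal P}(\gamma):\rho_V=0\}$ (those which also locally preserve the pseudo arc-length parameter). For $V\in\mathfrak X^*_{\mathcal P}(\gamma)$ let $D_V$ be the tensor derivation acting on $\mathcal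 P$ as an $\mathbb R$-linear derivation $f\mapsto V(f)$, and on $\mathfrak X_{\mathcal P}(\gamma)$ $\mathbb R$-linearly with $D_V(fU)=V(f)U+fD_VU$, such that $V(f')=V(f)'+\frac1{2a}\rho_Vf'$ for all $f\in\mathcal P$, $$V(k_1)=\tfrac1a\bigl(\tfrac1a\varphi_V'''+k_1\varphi_V'+(k_1\varphi_V)'\bigr)-\tfrac1a\bigl((k_2\psi_V)'+k_2\psi_V'\bigr)+\tfrac1a\bigl(\tfrac1{2a}\rho_V''+k_1\rho_V-2Gg_V'\bigr),$$ $$V(k_2)=\tfrac1a\bigl((k_2\varphi_V)'+k_2\varphi_V'\bigr)+\tfrac{\varepsilon_1\varepsilon_2}a\bigl(\tfrac1a\psi_V'''+k_1\psi_V'+(k_1\psi_V)'\bigr)+\tfrac1ak_2\rho_V-\varepsilon_2Gl_V,$$ $$D_VT=-\alpha_VT+\varphi_VW_1+\psi_VW_2,\qquad D_VW_1=-\beta_VT+\varepsilon_1\varphi_VN+\tfrac1a\psi_V'W_2,$$ $$D_VN=-\varepsilon_1\beta_VW_1+\alpha_VN+\tfrac{\varepsilon_1}a\delta_VW_2,\qquad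 D_VW_2=\tfrac{\varepsilon_1\varepsilon_2}a\delta_VT-\tfrac{\varepsilon_1\varepsilon_2}a\psi_V'W_1+\varepsilon_2\psi_VN.$$ Then substituting the curvature functions of $\gamma$ and their derivatives for the indeterminates turns $\nabla_T$ and $\langle\cdot,\cdot\rangle$ on $\mathfrak X_{\mathcal P}(\gamma)$ into the covariant derivative along $\gamma$ and the scalar product of the corresponding vector fields along $\gamma$; this substitution is injective on $\mathfrak X_{\mathcal P}(\gamma)$ if the curvature functions of $\gamma$ satisfy no nontrivial polynomial differential equation. For every $V\in\mathfrak X^*_{\mathcal P}(\gamma)$ the tensor derivation $D_V$ exists and is unique. The bracket $[V_1,V_2]_\gamma=D_{V_1}V_2-D_{V_2}V_1$ on $\mathfrak X^*_{\mathcal P}(\gamma)$ is $\mathbb R$-bilinear and has the following properties. (a) If $V_1,V_2\in\mathfrak X^*_{\mathcal P}(\gamma)$, then $[V_1,V_2]_\gamma\in\mathfrak X^*_{\mathcal P}(\gamma)$. (b) $[V_1,V_2]_\gamma(f)=V_1(V_2(f))-V_2(V_1(f))$ for all $V_1,V_2\in\mathfrak X^*_{\mathcal P}(\gamma)$ and $f\in\mathcal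 P$. (c) $[\cdot,\cdot]_\gamma$ is skew-symmetric. (d) For $V_1,V_2\in\mathfrak X^*_{\mathcal P}(\gamma)$ and $U\in\mathfrak X_{\mathcal P}(\gamma)$, $$D_{[V_1,V_2]_\gamma}U-D_{V_1}D_{V_2}U+D_{V_2}D_{V_1}U=G\bigl(\langle U,V_1\rangle V_2-\langle U,V_2\rangle V_1\bigr).$$ (e) $[\cdot,\cdot]_\gamma$ satisfies the Jacobi identity. (f) The linear subspace $T_{\mathcal P,\gamma}(\Lambda)$ is closed under $[\cdot,\cdot]_\gamma$, so it is a Lie subalgebra of $\mathfrak X^*_{\mathcal P}(\gamma)$. -/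

import Mathlib

open scoped Manifold ContDiff Topology

noncomputable section

namespace NullCurve

/-! ### Four-dimensional semi-Riemannian space forms -/

/-- The model space of four-dimensional manifolds. -/
abbrev E4 : Type := EuclideanSpace ℝ (Fin 4)

/-- Smooth (globally defined) vector fields on a 4-manifold. -/
def IsSmoothField {M : Type*} [TopologicalSpace M] [ChartedSpace E4 M]
    [IsManifold 𝓘(ℝ, E4) ∞ M] (X : Π x : M, TangentSpace 𝓘(ℝ, E4) x) : Prop :=
  ContMDiff 𝓘(ℝ, E4) 𝓘(ℝ, E4).tangent ∞ (fun x => (⟨x, X x⟩ : TangentBundle 𝓘(ℝ, E4) M))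

/-- A semi-Riemannian metric: a smooth field of nondegenerate symmetric bilinear forms on the
tangent spaces. -/
structure SemiRiemannianMetric (M : Type*) [TopologicalSpace M] [ChartedSpace E4 M]
    [IsManifold 𝓘(ℝ, E4) ∞ M] where
  /-- the bilinear form on each tangent space -/
  form (x : M) : TangentSpace 𝓘(ℝ, E4) x →L[ℝ] TangentSpace 𝓘(ℝ, E4) x →L[ℝ] ℝ
  symm (x : M) (v w : TangentSpace 𝓘(ℝ, E4) x) : form x v w = form x w v
  nondegenerate (x : M) (v : TangentSpace 𝓘(ℝ, E4) x) (hv : ∀ w, form x v w = 0) : v = 0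
  contMDiff : ContMDiff 𝓘(ℝ, E4) (𝓘(ℝ, E4).prod 𝓘(ℝ, E4 →L[ℝ] E4 →L[ℝ] ℝ)) ∞
    (fun x => Bundle.TotalSpace.mk' (E4 →L[ℝ] E4 →L[ℝ] ℝ)
      (E := fun x : M => TangentSpace 𝓘(ℝ, E4) x →L[ℝ] TangentSpace 𝓘(ℝ, E4) x →L[ℝ] ℝ)
      x (form x))

section Geometry

variable {M : Type*} [TopologicalSpace M] [ChartedSpace E4 M] [IsManifold 𝓘(ℝ, E4) ∞ M]

/-- The metric has index `q`: at every point `q` is the largest dimension of a subspace of the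
tangent space on which the metric is negative definite. -/
def SemiRiemannianMetric.HasIndex (g : SemiRiemannianMetric M) (q : ℕ) : Prop :=
  ∀ x : M, IsGreatest
    {n : ℕ | ∃ S : Submodule ℝ (TangentSpace 𝓘(ℝ, E4) x),
      Module.finrank ℝ S = n ∧ ∀ v ∈ S, v ≠ 0 → g.form x v v < 0} q

/-- `cov` is the Levi-Civita connection of `g`: it is torsion free and compatible with `g`.
(In Mathlib's convention `cov Y x v` is `∇_v Y` at `x`.) -/
def SemiRiemannianMetric.IsLeviCivita (g : SemiRiemannianMetric M)
    (cov : CovariantDerivative 𝓘(ℝ, E4) E4 (TangentSpace 𝓘(ℝ, E4) : M → Type _)) : Prop :=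
  (∀ X Y : Π x : M, TangentSpace 𝓘(ℝ, E4) x, IsSmoothField X → IsSmoothField Y → ∀ x : M,
    cov Y x (X x) - cov X x (Y x) = VectorField.mlieBracket 𝓘(ℝ, E4) X Y x) ∧
  (∀ X Y Z : Π x : M, TangentSpace 𝓘(ℝ, E4) x,
    IsSmoothField X → IsSmoothField Y → IsSmoothField Z → ∀ x : M,
    mvfderiv 𝓘(ℝ, E4) (fun y => g.form y (Y y) (Z y)) x (X x) =
      g.form x (cov Y x (X x)) (Z x) + g.form x (Y x) (cov Z x (X x)))

/-- The curvature tensor `R(X,Y)Z = -∇_X ∇_Y Z + ∇_Y ∇_X Z + ∇_{[X,Y]} Z`. -/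
def curvature (cov : CovariantDerivative 𝓘(ℝ, E4) E4 (TangentSpace 𝓘(ℝ, E4) : M → Type _))
    (X Y Z : Π x : M, TangentSpace 𝓘(ℝ, E4) x) (x : M) : TangentSpace 𝓘(ℝ, E4) x :=
  -(cov (fun y => cov Z y (Y y)) x (X x)) + cov (fun y => cov Z y (X y)) x (Y x)
    + cov Z x (VectorField.mlieBracket 𝓘(ℝ, E4) X Y x)

/-- Constant sectional curvature `G`: every nondegenerate tangent plane, spanned by the values at
`x` of two vector fields `X`, `Y`, has sectional curvature `G`. -/
def SemiRiemannianMetric.HasConstantCurvature (g : SemiRiemannianMetric M)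
    (cov : CovariantDerivative 𝓘(ℝ, E4) E4 (TangentSpace 𝓘(ℝ, E4) : M → Type _))
    (G : ℝ) : Prop :=
  ∀ X Y : Π x : M, TangentSpace 𝓘(ℝ, E4) x, IsSmoothField X → IsSmoothField Y → ∀ x : M,
    g.form x (X x) (X x) * g.form x (Y x) (Y x) - g.form x (X x) (Y x) ^ 2 ≠ 0 →
    g.form x (curvature cov X Y X x) (Y x) /
      (g.form x (X x) (X x) * g.form x (Y x) (Y x) - g.form x (X x) (Y x) ^ 2) = G

/-! ### Covariant differentiation along a curve, and Cartan curves -/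

/-- The velocity of a curve. -/
def velocity (γ : ℝ → M) (s : ℝ) : TangentSpace 𝓘(ℝ, E4) (γ s) :=
  mfderiv 𝓘(ℝ, ℝ) 𝓘(ℝ, E4) γ s (1 : ℝ)

/-- `V` is a smooth vector field along `γ` on `J` and `V'` is its covariant derivative along `γ`.
Near every parameter, `V` is a combination `∑ vᵢ • Eᵢ ∘ γ` with smooth functions `vᵢ` and smooth
vector fields `Eᵢ` of the ambient manifold, and then its covariant derivative is
`∑ (vᵢ' • Eᵢ ∘ γ + vᵢ • ∇_{γ'} Eᵢ)`. -/
def IsCovDerivAlong (cov : CovariantDerivative 𝓘(ℝ, E4) E4 (TangentSpace 𝓘(ℝ, E4) : M → Type _))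
    (γ : ℝ → M) (J : Set ℝ) (V V' : Π s : ℝ, TangentSpace 𝓘(ℝ, E4) (γ s)) : Prop :=
  ∀ s ∈ J, ∃ (n : ℕ) (E : Fin n → Π x : M, TangentSpace 𝓘(ℝ, E4) x) (v : Fin n → ℝ → ℝ),
    (∀ i, IsSmoothField (E i)) ∧ (∀ i, ContDiffAt ℝ ∞ (v i) s) ∧
    (∀ᶠ t in 𝓝 s, V t = ∑ i, v i t • E i (γ t)) ∧
    V' s = ∑ i, (deriv (v i) s • E i (γ s) + v i s • cov (E i) (γ s) (velocity γ s))

/-- A null curve, parametrized by the pseudo arc-length parameter `σ_a` on an open interval,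
together with its Cartan frame `T = γ', W₁, N, W₂`, the causal characters `ε₁, ε₂` of `W₁, W₂` and
the curvatures `k 0 = k₁`, `k 1 = k₂` given by the Cartan equations. -/
structure CartanCurve (g : SemiRiemannianMetric M)
    (cov : CovariantDerivative 𝓘(ℝ, E4) E4 (TangentSpace 𝓘(ℝ, E4) : M → Type _)) (a : ℝ) where
  /-- the interval of definition -/
  dom : Set ℝ
  isOpen_dom : IsOpen dom
  ordConnected_dom : dom.OrdConnected
  nonempty_dom : dom.Nonempty
  /-- the curve -/
  curve : ℝ → M
  smooth : ContMDiffOn 𝓘(ℝ, ℝ) 𝓘(ℝ, E4) ∞ curve dom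
  /-- the first screen vector field -/
  W₁ : Π s : ℝ, TangentSpace 𝓘(ℝ, E4) (curve s)
  /-- the null transversal vector field -/
  N : Π s : ℝ, TangentSpace 𝓘(ℝ, E4) (curve s)
  /-- the second screen vector field -/
  W₂ : Π s : ℝ, TangentSpace 𝓘(ℝ, E4) (curve s)
  /-- the causal character of `W₁` -/
  ε₁ : ℝ
  /-- the causal character of `W₂` -/
  ε₂ : ℝ
  ε₁_eq : ε₁ = 1 ∨ ε₁ = -1
  ε₂_eq : ε₂ = 1 ∨ ε₂ = -1
  /-- the curvatures -/
  k : Fin 2 → ℝ → ℝ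
  smooth_k : ∀ i, ContDiffOn ℝ ∞ (k i) dom
  T_T : ∀ s ∈ dom, g.form (curve s) (velocity curve s) (velocity curve s) = 0
  N_N : ∀ s ∈ dom, g.form (curve s) (N s) (N s) = 0
  T_N : ∀ s ∈ dom, g.form (curve s) (velocity curve s) (N s) = -1
  W₁_T : ∀ s ∈ dom, g.form (curve s) (W₁ s) (velocity curve s) = 0
  W₁_N : ∀ s ∈ dom, g.form (curve s) (W₁ s) (N s) = 0
  W₂_T : ∀ s ∈ dom, g.form (curve s) (W₂ s) (velocity curve s) = 0
  W₂_N : ∀ s ∈ dom, g.form (curve s) (W₂ s) (N s) = 0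
  W₁_W₁ : ∀ s ∈ dom, g.form (curve s) (W₁ s) (W₁ s) = ε₁
  W₂_W₂ : ∀ s ∈ dom, g.form (curve s) (W₂ s) (W₂ s) = ε₂
  W₁_W₂ : ∀ s ∈ dom, g.form (curve s) (W₁ s) (W₂ s) = 0
  cartan_T : IsCovDerivAlong cov curve dom (velocity curve) (fun s => a • W₁ s)
  cartan_W₁ : IsCovDerivAlong cov curve dom W₁
    (fun s => -(k 0 s) • velocity curve s + (a * ε₁) • N s)
  cartan_N : IsCovDerivAlong cov curve dom N
    (fun s => -(ε₁ * k 0 s) • W₁ s + (ε₂ * k 1 s) • W₂ s)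
  cartan_W₂ : IsCovDerivAlong cov curve dom W₂ (fun s => k 1 s • velocity curve s)

end Geometry

/-! ### Differential polynomials in the curvatures and `𝒫`-local vector fields -/

/-- The algebra `𝒫` of polynomials in `k₁`, `k₂` and their derivatives of arbitrary order;
the indeterminate `(i, m)` is the `m`-th derivative of `k₁` (`i = 0`) or of `k₂` (`i = 1`). -/
abbrev DiffPoly : Type := MvPolynomial (Fin 2 × ℕ) ℝ

/-- The derivation `f ↦ f'` of `𝒫`, sending each `kᵢ^(m)` to `kᵢ^(m+1)`. -/
def total : Derivation ℝ DiffPoly DiffPoly :=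
  MvPolynomial.mkDerivation ℝ fun p => MvPolynomial.X (p.1, p.2 + 1)

/-- The first curvature as an element of `𝒫`. -/
def k₁ : DiffPoly := MvPolynomial.X (0, 0)

/-- The second curvature as an element of `𝒫`. -/
def k₂ : DiffPoly := MvPolynomial.X (1, 0)

/-- `𝒫`-local vector fields `f T + h W₁ + g N + l W₂`, given by their components
`(f, h, g, l)` in the Cartan frame. -/
abbrev LocalField : Type := Fin 4 → DiffPoly

/-- The frame field `T` as a `𝒫`-local vector field. -/
def fT : LocalField := Pi.single 0 1

/-- The frame field `W₁` as a `𝒫`-local vector field. -/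
def fW₁ : LocalField := Pi.single 1 1

/-- The frame field `N` as a `𝒫`-local vector field. -/
def fN : LocalField := Pi.single 2 1

/-- The frame field `W₂` as a `𝒫`-local vector field. -/
def fW₂ : LocalField := Pi.single 3 1

/-- The constants attached to a Cartan curve: the normalization `a` of the parameter, the causal
characters of the screen vector fields and the curvature `G` of the ambient space. -/
structure Consts where
  /-- the normalization of the pseudo arc-length parameter -/
  a : ℝ
  /-- the causal character of `W₁` -/
  ε₁ : ℝ
  /-- the causal character of `W₂` -/
  ε₂ : ℝ
  /-- the sectional curvature of the ambient space -/
  G : ℝ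

section Formal

open MvPolynomial (C X)

/-- The products of the vectors of the Cartan frame. -/
def gram (c : Consts) : Matrix (Fin 4) (Fin 4) DiffPoly :=
  !![0, 0, -1, 0;
     0, C c.ε₁, 0, 0;
     -1, 0, 0, 0;
     0, 0, 0, C c.ε₂]

/-- The metric on `𝒫`-local vector fields. -/
def localInner (c : Consts) (U V : LocalField) : DiffPoly :=
  ∑ i, ∑ j, U i * gram c i j * V j

/-- The Cartan equations: the rows are `∇_T T`, `∇_T W₁`, `∇_T N`, `∇_T W₂`. -/
def cartanMatrix (c : Consts) : Matrix (Fin 4) (Fin 4) DiffPoly :=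
  !![0, C c.a, 0, 0;
     -k₁, 0, C (c.a * c.ε₁), 0;
     0, -(C c.ε₁ * k₁), 0, C c.ε₂ * k₂;
     k₂, 0, 0, 0]

/-- The covariant derivative `∇_T` on `𝒫`-local vector fields. -/
def nabla (c : Consts) : LocalField →ₗ[ℝ] LocalField where
  toFun V := fun j => total (V j) + ∑ i, V i * cartanMatrix c i j
  map_add' U V := by
    funext j
    simp only [Pi.add_apply, map_add, add_mul, Finset.sum_add_distrib]
    ring
  map_smul' r V := by
    funext j
    simp only [Pi.smul_apply, Derivation.map_smul, smul_mul_assoc, ← Finset.smul_sum,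
      ← smul_add, RingHom.id_apply]

/-- `φ_V = ε₁ ⟨∇_T V, W₁⟩`. -/
def phi (c : Consts) (V : LocalField) : DiffPoly := C c.ε₁ * localInner c (nabla c V) fW₁

/-- `ψ_V = ε₂ ⟨∇_T V, W₂⟩`. -/
def psi (c : Consts) (V : LocalField) : DiffPoly := C c.ε₂ * localInner c (nabla c V) fW₂

/-- `ρ_V = -ε₁ ⟨∇_T² V, W₁⟩`. -/
def rho (c : Consts) (V : LocalField) : DiffPoly :=
  -(C c.ε₁ * localInner c (nabla c (nabla c V)) fW₁)

/-- `α_V = (φ_V' + ρ_V / 2) / a`. -/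
def alpha (c : Consts) (V : LocalField) : DiffPoly :=
  C (1 / c.a) * (total (phi c V) + C (1 / 2) * rho c V)

/-- `β_V = (α_V' + k₁ φ_V - k₂ ψ_V - G g_V) / a`. -/
def beta (c : Consts) (V : LocalField) : DiffPoly :=
  C (1 / c.a) * (total (alpha c V) + k₁ * phi c V - k₂ * psi c V - C c.G * V 2)

/-- `δ_V = ψ_V'' / a + k₁ ψ_V + ε₁ ε₂ k₂ φ_V`. -/
def delta (c : Consts) (V : LocalField) : DiffPoly :=
  C (1 / c.a) * total (total (psi c V)) + k₁ * psi c V + C (c.ε₁ * c.ε₂) * (k₂ * phi c V)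

/-- The variation `V(k₁)` of the first curvature. -/
def varK₁ (c : Consts) (V : LocalField) : DiffPoly :=
  C (1 / c.a) * (C (1 / c.a) * total (total (total (phi c V)))
      + k₁ * total (phi c V) + total (k₁ * phi c V))
    - C (1 / c.a) * (total (k₂ * psi c V) + k₂ * total (psi c V))
    + C (1 / c.a) * (C (1 / (2 * c.a)) * total (total (rho c V)) + k₁ * rho c V
      - C (2 * c.G) * total (V 2))

/-- The variation `V(k₂)` of the second curvature. -/
def varK₂ (c : Consts) (V : LocalField) : DiffPoly :=
  C (1 / c.a) * (total (k₂ * phi c V) + k₂ * total (phi c V))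
    + C (c.ε₁ * c.ε₂ / c.a) * (C (1 / c.a) * total (total (total (psi c V)))
      + k₁ * total (psi c V) + total (k₁ * psi c V))
    + C (1 / c.a) * (k₂ * rho c V) - C (c.ε₂ * c.G) * V 3

/-- The coefficients of `D_V T`, `D_V W₁`, `D_V N`, `D_V W₂` (rows) in the Cartan frame. -/
def variationMatrix (c : Consts) (V : LocalField) : Matrix (Fin 4) (Fin 4) DiffPoly :=
  !![-alpha c V, phi c V, 0, psi c V;
     -beta c V, 0, C c.ε₁ * phi c V, C (1 / c.a) * total (psi c V);
     0, -(C c.ε₁ * beta c V), alpha c V, C (c.ε₁ / c.a) * delta c V;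
     C (c.ε₁ * c.ε₂ / c.a) * delta c V, -(C (c.ε₁ * c.ε₂ / c.a) * total (psi c V)),
       C c.ε₂ * psi c V, 0]

/-- A tensor derivation on `𝒫`-local vector fields along the curve, with action `d` on `𝒫` and
action `D` on vector fields, fulfilling the three conditions that determine `D_V`: the rule for
`V(f')`, the prescribed variations of the curvatures, and the prescribed variation of the Cartan
frame. -/
structure IsVariationDerivation (c : Consts) (V : LocalField)
    (d : Derivation ℝ DiffPoly DiffPoly) (D : LocalField →ₗ[ℝ] LocalField) : Prop where
  leibniz : ∀ (f : DiffPoly) (U : LocalField), D (f • U) = d f • U + f • D U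
  map_total : ∀ f : DiffPoly, d (total f) = total (d f) + C (1 / (2 * c.a)) * rho c V * total f
  map_k₁ : d k₁ = varK₁ c V
  map_k₂ : d k₂ = varK₂ c V
  map_T : D fT = variationMatrix c V 0
  map_W₁ : D fW₁ = variationMatrix c V 1
  map_N : D fN = variationMatrix c V 2
  map_W₂ : D fW₂ = variationMatrix c V 3

/-- `V(kᵢ^(m))`, obtained from `V(k₁)` and `V(k₂)` through `V(f') = V(f)' + ρ_V f' / (2a)`. -/
def varJet (c : Consts) (V : LocalField) (i : Fin 2) : ℕ → DiffPoly
  | 0 => if i = 0 then varK₁ c V else varK₂ c V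
  | m + 1 => total (varJet c V i m) + C (1 / (2 * c.a)) * rho c V * X (i, m + 1)

/-- The action `f ↦ V(f)` of a `𝒫`-local vector field on `𝒫`. -/
def act (c : Consts) (V : LocalField) : Derivation ℝ DiffPoly DiffPoly :=
  MvPolynomial.mkDerivation ℝ fun p => varJet c V p.1 p.2

/-- The derivation `D_V` on `𝒫`-local vector fields. -/
def covD (c : Consts) (V : LocalField) : LocalField →ₗ[ℝ] LocalField where
  toFun U := fun j => act c V (U j) + ∑ i, U i * variationMatrix c V i j
  map_add' U W := by
    funext j
    simp only [Pi.add_apply, map_add, add_mul, Finset.sum_add_distrib]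
    ring
  map_smul' r U := by
    funext j
    simp only [Pi.smul_apply, Derivation.map_smul, smul_mul_assoc, ← Finset.smul_sum,
      ← smul_add, RingHom.id_apply]

/-- The bracket `[V₁, V₂]_γ = D_{V₁} V₂ - D_{V₂} V₁`. -/
def bracket (c : Consts) (V₁ V₂ : LocalField) : LocalField := covD c V₁ V₂ - covD c V₂ V₁

theorem localInner_add_left (c : Consts) (U V W : LocalField) :
    localInner c (U + V) W = localInner c U W + localInner c V W := by
  simp only [localInner, Pi.add_apply, add_mul, Finset.sum_add_distrib]

theorem localInner_smul_left (c : Consts) (r : ℝ) (U W : LocalField) :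
    localInner c (r • U) W = r • localInner c U W := by
  simp only [localInner, Pi.smul_apply, smul_mul_assoc, Finset.smul_sum]

/-- The `𝒫`-local vector fields that locally preserve the causal character:
`⟨∇_T V, T⟩ = 0`. -/
def causalFields (c : Consts) : Submodule ℝ LocalField where
  carrier := {V | localInner c (nabla c V) fT = 0}
  add_mem' {U V} hU hV := by
    simp only [Set.mem_ofPred_eq] at *
    rw [map_add, localInner_add_left, hU, hV, add_zero]
  zero_mem' := by simp [localInner]
  smul_mem' r V hV := by
    simp only [Set.mem_ofPred_eq] at *
    rw [map_smul, localInner_smul_left, hV, smul_zero]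

/-- The `𝒫`-local vector fields that locally preserve the causal character and the pseudo
arc-length parameter: `⟨∇_T V, T⟩ = ⟨∇_T² V, W₁⟩ = 0`. -/
def arcLengthFields (c : Consts) : Submodule ℝ LocalField where
  carrier := {V | localInner c (nabla c V) fT = 0 ∧ localInner c (nabla c (nabla c V)) fW₁ = 0}
  add_mem' {U V} hU hV := by
    simp only [Set.mem_ofPred_eq] at *
    simp only [map_add, localInner_add_left, hU, hV, add_zero, and_self]
  zero_mem' := by simp [localInner]
  smul_mem' r V hV := by
    simp only [Set.mem_ofPred_eq] at *
    simp only [map_smul, localInner_smul_left, hV, smul_zero, and_self]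

end Formal

/-! ### Values along a Cartan curve -/

section Values

variable {M : Type*} [TopologicalSpace M] [ChartedSpace E4 M] [IsManifold 𝓘(ℝ, E4) ∞ M]
  {g : SemiRiemannianMetric M}
  {cov : CovariantDerivative 𝓘(ℝ, E4) E4 (TangentSpace 𝓘(ℝ, E4) : M → Type _)} {a : ℝ}

/-- The constants of a Cartan curve in a space form of curvature `G`. -/
def CartanCurve.consts (γ : CartanCurve g cov a) (G : ℝ) : Consts := ⟨a, γ.ε₁, γ.ε₂, G⟩

/-- The value at `s` of a differential polynomial in the curvatures of `γ`. -/
def CartanCurve.value (γ : CartanCurve g cov a) (f : DiffPoly) (s : ℝ) : ℝ :=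
  MvPolynomial.eval (fun p => iteratedDeriv p.2 (γ.k p.1) s) f

/-- The vector field along `γ` given by a `𝒫`-local vector field. -/
def CartanCurve.field (γ : CartanCurve g cov a) (V : LocalField) (s : ℝ) :
    TangentSpace 𝓘(ℝ, E4) (γ.curve s) :=
  γ.value (V 0) s • velocity γ.curve s + γ.value (V 1) s • γ.W₁ s
    + γ.value (V 2) s • γ.N s + γ.value (V 3) s • γ.W₂ s

end Values

end NullCurve

end

open NullCurve

namespace NullCurve

open MvPolynomial (C X)

/-! The operator `covD c V` is built to mimic differentiation of fields along a variation of the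
curve with variation field V. Three laws, checked on components, carry this analogy. It is a metric
derivation (`act_localInner`). It satisfies D_V T = ∇_T V + r_V T with r_V = ρ_V/(2a) (`covD_fT`),
so that formally [V, T] = r_V T for a torsion-free connection. It commutes with ∇_T up to r_V ∇_T
and the constant-curvature term G(⟨U,V⟩T - ⟨U,T⟩V) (`covD_nabla`). After that, explicit formulas for
φ, ψ, ρ, α, β, δ play no role in the bracket identities.

For V₁, V₂ preserving the causal character, let R be the commutator of D_{V₁} and D_{V₂} plus G
times the wedge operator of V₁, V₂. Since the wedge operator is linear over 𝒫 and skew-adjoint, R is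
again a metric derivation, over the commutator of the actions on 𝒫. The laws for D_{V₁} and D_{V₂}
give the analogous laws for R, with [V₁,V₂] as variation field and s = V₁(r_{V₂}) - V₂(r_{V₁}) as
factor. Pairing R T with T puts the bracket among the causal fields; pairing R W₁ with W₁ identifies
s with the factor of the bracket.

Hence D_{[V₁,V₂]} - R is a metric derivation that commutes with ∇_T and kills T. Such a derivation
vanishes (`eq_zero_of_commute_nabla`), because T generates the frame and the curvatures through the
Cartan equations. Its vanishing on 𝒫 is the commutator rule, and its vanishing on fields is the
curvature identity. The Jacobi identity follows by a cyclic sum and the algebraic Bianchi identity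
for the wedge. -/

/-- The constants occurring for a Cartan curve. -/
structure Consts.Admissible (c : Consts) : Prop where
  a_ne : c.a ≠ 0
  sq₁ : c.ε₁ * c.ε₁ = 1
  sq₂ : c.ε₂ * c.ε₂ = 1

/-! ### Differential polynomials, the product and the derivations in components -/

theorem localInner_apply (c : Consts) (U V : LocalField) :
    localInner c U V = -(U 0 * V 2) - U 2 * V 0 + C c.ε₁ * (U 1 * V 1) + C c.ε₂ * (U 3 * V 3) := by
  simp [localInner, gram, Fin.sum_univ_four]
  ring

theorem nabla_apply (c : Consts) (V : LocalField) (j : Fin 4) :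
    nabla c V j = total (V j) + ∑ i, V i * cartanMatrix c i j := rfl

theorem covD_apply (c : Consts) (V U : LocalField) (j : Fin 4) :
    covD c V U j = act c V (U j) + ∑ i, U i * variationMatrix c V i j := rfl

theorem derivation_C_mul (d : Derivation ℝ DiffPoly DiffPoly) (r : ℝ) (f : DiffPoly) :
    d (C r * f) = C r * d f := by
  rw [← MvPolynomial.smul_eq_C_mul, ← MvPolynomial.smul_eq_C_mul, d.map_smul]

theorem derivation_C (d : Derivation ℝ DiffPoly DiffPoly) (r : ℝ) : d (C r) = 0 :=
  d.map_algebraMap r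

/-- The reparametrization factor `ρ_V / (2a)`. -/
noncomputable def rate (c : Consts) (V : LocalField) : DiffPoly := C (1 / (2 * c.a)) * rho c V

/-- The commutator of two derivations is a derivation, so it suffices to compare on the jet
variables, where the recursion defining `varJet` is exactly this rule. -/
theorem act_total (c : Consts) (V : LocalField) (f : DiffPoly) :
    act c V (total f) = total (act c V f) + rate c V * total f := by
  induction f using MvPolynomial.induction_on with
  | C r => simp
  | add p q hp hq => simp only [map_add, hp, hq]; ring
  | mul_X p n hp =>
    have h : act c V (total (X n)) = total (act c V (X n)) + rate c V * total (X n) := by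
      simp [act, total, MvPolynomial.mkDerivation_X, varJet, rate]
    simp only [Derivation.leibniz, smul_eq_mul, map_add, hp, h]
    ring

theorem act_k₁ (c : Consts) (V : LocalField) : act c V k₁ = varK₁ c V := by
  simp [act, k₁, MvPolynomial.mkDerivation_X, varJet]

theorem act_k₂ (c : Consts) (V : LocalField) : act c V k₂ = varK₂ c V := by
  simp [act, k₂, MvPolynomial.mkDerivation_X, varJet]

theorem covD_smul (c : Consts) (V U : LocalField) (f : DiffPoly) :
    covD c V (f • U) = act c V f • U + f • covD c V U := by
  funext j
  simp only [covD_apply, Pi.smul_apply, Pi.add_apply, smul_eq_mul, Derivation.leibniz,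
    Fin.sum_univ_four]
  ring

theorem nabla_smul (c : Consts) (U : LocalField) (f : DiffPoly) :
    nabla c (f • U) = total f • U + f • nabla c U := by
  funext j
  simp only [nabla_apply, Pi.smul_apply, Pi.add_apply, smul_eq_mul, Derivation.leibniz,
    Fin.sum_univ_four]
  ring

theorem C_sq {r : ℝ} (h : r * r = 1) : (C r : DiffPoly) * C r = 1 := by
  rw [← MvPolynomial.C_mul, h, MvPolynomial.C_1]

theorem C_mul_inv {r : ℝ} (h : r ≠ 0) : (C r : DiffPoly) * C (1 / r) = 1 := by
  rw [← MvPolynomial.C_mul, mul_one_div_cancel h, MvPolynomial.C_1]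

theorem C_two : (C 2 : DiffPoly) = 2 := map_ofNat C 2

theorem two_mul_C_half : (2 : DiffPoly) * C (1 / 2) = 1 := by
  rw [← C_two, ← MvPolynomial.C_mul]; norm_num

theorem C_div_eq (r s : ℝ) : (C (r / s) : DiffPoly) = C r * C (1 / s) := by
  rw [← MvPolynomial.C_mul, mul_one_div]

theorem C_inv_two_mul (r : ℝ) : (C (1 / (2 * r)) : DiffPoly) = C (1 / 2) * C (1 / r) := by
  rw [← MvPolynomial.C_mul, one_div_mul_one_div]

/-- Expansions of the Cartan equations. -/
theorem nabla_zero (c : Consts) (V : LocalField) :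
    nabla c V 0 = total (V 0) - k₁ * V 1 + k₂ * V 3 := by
  simp [nabla_apply, cartanMatrix, Fin.sum_univ_four]; ring

theorem nabla_one (c : Consts) (V : LocalField) :
    nabla c V 1 = total (V 1) + C c.a * V 0 - C c.ε₁ * (k₁ * V 2) := by
  simp [nabla_apply, cartanMatrix, Fin.sum_univ_four]; ring

theorem nabla_two (c : Consts) (V : LocalField) :
    nabla c V 2 = total (V 2) + C c.a * C c.ε₁ * V 1 := by
  simp [nabla_apply, cartanMatrix, Fin.sum_univ_four]; ring

theorem nabla_three (c : Consts) (V : LocalField) :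
    nabla c V 3 = total (V 3) + C c.ε₂ * (k₂ * V 2) := by
  simp [nabla_apply, cartanMatrix, Fin.sum_univ_four]; ring

theorem covD_zero (c : Consts) (V U : LocalField) :
    covD c V U 0 = act c V (U 0) - alpha c V * U 0 - beta c V * U 1
      + C c.ε₁ * C c.ε₂ * C (1 / c.a) * (delta c V * U 3) := by
  have := C_div_eq (c.ε₁ * c.ε₂) c.a
  rw [MvPolynomial.C_mul] at this
  simp only [covD_apply, variationMatrix, Fin.sum_univ_four, this]
  simp; ring

theorem covD_one (c : Consts) (V U : LocalField) :
    covD c V U 1 = act c V (U 1) + phi c V * U 0 - C c.ε₁ * (beta c V * U 2)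
      - C c.ε₁ * C c.ε₂ * C (1 / c.a) * (total (psi c V) * U 3) := by
  have := C_div_eq (c.ε₁ * c.ε₂) c.a
  rw [MvPolynomial.C_mul] at this
  simp only [covD_apply, variationMatrix, Fin.sum_univ_four, this]
  simp; ring

theorem covD_two (c : Consts) (V U : LocalField) :
    covD c V U 2 = act c V (U 2) + C c.ε₁ * (phi c V * U 1) + alpha c V * U 2
      + C c.ε₂ * (psi c V * U 3) := by
  simp only [covD_apply, variationMatrix, Fin.sum_univ_four]
  simp; ring

theorem covD_three (c : Consts) (V U : LocalField) :
    covD c V U 3 = act c V (U 3) + psi c V * U 0 + C (1 / c.a) * (total (psi c V) * U 1)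
      + C c.ε₁ * C (1 / c.a) * (delta c V * U 2) := by
  have := C_div_eq c.ε₁ c.a
  simp only [covD_apply, variationMatrix, Fin.sum_univ_four, this]
  simp; ring

/-! ### The three laws of D_V: metric, torsion and curvature -/

theorem total_localInner {c : Consts} (hc : c.Admissible) (U W : LocalField) :
    total (localInner c U W) = localInner c (nabla c U) W + localInner c U (nabla c W) := by
  have h1 := C_sq hc.sq₁
  have h2 := C_sq hc.sq₂
  simp only [localInner_apply, nabla_zero, nabla_one, nabla_two, nabla_three, map_add, map_sub,
    map_neg, derivation_C, Derivation.leibniz, smul_eq_mul]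
  linear_combination (k₁ * U 1 * W 2 + k₁ * U 2 * W 1) * h1 - (k₂ * U 3 * W 2 + k₂ * U 2 * W 3) * h2

/-- The Gram matrix is constant, and the variation matrix is skew with respect to it. -/
theorem act_localInner {c : Consts} (hc : c.Admissible) (V U W : LocalField) :
    act c V (localInner c U W) = localInner c (covD c V U) W + localInner c U (covD c V W) := by
  have h1 := C_sq hc.sq₁
  have h2 := C_sq hc.sq₂
  simp only [localInner_apply, covD_zero, covD_one, covD_two, covD_three, map_add, map_sub,
    map_neg, derivation_C, Derivation.leibniz, smul_eq_mul]
  grind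

theorem nabla_two_eq_zero {c : Consts} {V : LocalField} (hV : V ∈ causalFields c) :
    nabla c V 2 = 0 := by
  have : localInner c (nabla c V) fT = 0 := hV
  simpa [localInner_apply, fT] using this

theorem phi_eq {c : Consts} (hc : c.Admissible) (V : LocalField) : phi c V = nabla c V 1 := by
  simp [phi, localInner_apply, fW₁, ← mul_assoc, C_sq hc.sq₁]

theorem psi_eq {c : Consts} (hc : c.Admissible) (V : LocalField) : psi c V = nabla c V 3 := by
  simp [psi, localInner_apply, fW₂, ← mul_assoc, C_sq hc.sq₂]

theorem rho_eq {c : Consts} (hc : c.Admissible) (V : LocalField) :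
    rho c V = -nabla c (nabla c V) 1 := by
  simp [rho, localInner_apply, fW₁, ← mul_assoc, C_sq hc.sq₁]

/-- The absence of an N-component in D_V T is the causal condition; the T-component is the
definition of α, whose term ρ/2 produces the factor ρ/(2a). -/
theorem covD_fT {c : Consts} (hc : c.Admissible) {V : LocalField} (hV : V ∈ causalFields c) :
    covD c V fT = nabla c V + rate c V • fT := by
  have h2 := nabla_two_eq_zero hV
  have hr := rho_eq hc V
  rw [nabla_one, h2] at hr
  have ha := C_mul_inv hc.a_ne
  have hh := two_mul_C_half
  have hp := phi_eq hc V
  funext j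
  fin_cases j
  · simp [covD_zero, fT, rate, alpha, hp]
    grind
  · simp [covD_one, fT, hp]
  · simp [covD_two, fT, h2]
  · simp [covD_three, fT, psi_eq hc]

/-- The curvature-like operator `U ↦ ⟨U, V⟩ W - ⟨U, W⟩ V`. -/
noncomputable def wedge (c : Consts) (V W U : LocalField) : LocalField :=
  localInner c U V • W - localInner c U W • V

/-- Replacing U by f U changes both sides equally, by `act_total`. On the frame the identity is what
dictates the coefficients: U = T yields α and β, U = W₁ yields δ and V(k₁), and U = N yields V(k₂).
-/
theorem covD_nabla {c : Consts} (hc : c.Admissible) {V : LocalField} (hV : V ∈ causalFields c)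
    (U : LocalField) :
    covD c V (nabla c U) = nabla c (covD c V U) + rate c V • nabla c U
      - (C c.G : DiffPoly) • wedge c V fT U := by
  have hg := nabla_two_eq_zero hV
  rw [nabla_two] at hg
  -- The causal condition enters only as g_V' = -a ε₁ h_V, which eliminates the derivatives of g_V.
  have hg' : total (V 2) = - (C c.a * C c.ε₁ * V 1) := by linear_combination hg
  have ha := C_mul_inv hc.a_ne
  have hh := two_mul_C_half
  have h1 := C_sq hc.sq₁
  have h2 := C_sq hc.sq₂
  have e := C_div_eq (c.ε₁ * c.ε₂) c.a
  rw [MvPolynomial.C_mul] at e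
  funext j
  fin_cases j <;>
  simp [covD_zero, covD_one, covD_two, covD_three, nabla_zero, nabla_one, nabla_two,
    nabla_three, wedge, localInner_apply, fT, act_total, act_k₁, act_k₂, -one_div, rate, varK₁, varK₂, beta, alpha, delta, e, hg', C_inv_two_mul, C_two] <;>
  grind

/-! ### Algebra of the product and of the wedge operator -/

theorem localInner_comm (c : Consts) (U W : LocalField) :
    localInner c U W = localInner c W U := by
  simp only [localInner_apply]; ring

theorem localInner_smul_left' (c : Consts) (f : DiffPoly) (U W : LocalField) :
    localInner c (f • U) W = f * localInner c U W := by
  simp only [localInner_apply, Pi.smul_apply, smul_eq_mul]; ring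

theorem localInner_smul_right (c : Consts) (f : DiffPoly) (U W : LocalField) :
    localInner c U (f • W) = f * localInner c U W := by
  simp only [localInner_apply, Pi.smul_apply, smul_eq_mul]; ring

theorem localInner_add_right (c : Consts) (U V W : LocalField) :
    localInner c U (V + W) = localInner c U V + localInner c U W := by
  simp only [localInner_apply, Pi.add_apply]; ring

theorem localInner_sub_left (c : Consts) (U V W : LocalField) :
    localInner c (U - V) W = localInner c U W - localInner c V W := by
  simp only [localInner_apply, Pi.sub_apply]; ring

theorem localInner_sub_right (c : Consts) (U V W : LocalField) :
    localInner c U (V - W) = localInner c U V - localInner c U W := by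
  simp only [localInner_apply, Pi.sub_apply]; ring

theorem wedge_add (c : Consts) (V W U U' : LocalField) :
    wedge c V W (U + U') = wedge c V W U + wedge c V W U' := by
  simp only [wedge, localInner_add_left]; module

theorem wedge_smul (c : Consts) (V W U : LocalField) (f : DiffPoly) :
    wedge c V W (f • U) = f • wedge c V W U := by
  simp only [wedge, localInner_smul_left']; module

theorem localInner_wedge (c : Consts) (V W U U' : LocalField) :
    localInner c (wedge c V W U) U' + localInner c U (wedge c V W U') = 0 := by
  simp only [wedge, localInner_sub_left, localInner_sub_right, localInner_smul_left',
    localInner_smul_right, localInner_comm c W U', localInner_comm c V U']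
  ring

theorem covD_wedge {c : Consts} (hc : c.Admissible) (X V W U : LocalField) :
    covD c X (wedge c V W U) = wedge c (covD c X V) W U + wedge c V (covD c X W) U
      + wedge c V W (covD c X U) := by
  simp only [wedge, map_sub, covD_smul, act_localInner hc]; module

theorem nabla_wedge {c : Consts} (hc : c.Admissible) (V W U : LocalField) :
    nabla c (wedge c V W U) = wedge c (nabla c V) W U + wedge c V (nabla c W) U
      + wedge c V W (nabla c U) := by
  simp only [wedge, map_sub, nabla_smul, total_localInner hc]; module

theorem nabla_C_smul (c : Consts) (U : LocalField) (r : ℝ) :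
    nabla c ((C r : DiffPoly) • U) = (C r : DiffPoly) • nabla c U := by
  rw [nabla_smul, derivation_C, zero_smul, zero_add]

/-! ### The curved commutator as a metric derivation -/

/-- The commutator of two variation derivations, corrected by the ambient curvature. -/
noncomputable def curvedCommutator (c : Consts) (V₁ V₂ U : LocalField) : LocalField :=
  covD c V₁ (covD c V₂ U) - covD c V₂ (covD c V₁ U) + (C c.G : DiffPoly) • wedge c V₁ V₂ U

theorem curvedCommutator_add (c : Consts) (V₁ V₂ U W : LocalField) :
    curvedCommutator c V₁ V₂ (U + W) = curvedCommutator c V₁ V₂ U + curvedCommutator c V₁ V₂ W := by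
  simp only [curvedCommutator, map_add, wedge_add]; module

theorem curvedCommutator_smul (c : Consts) (V₁ V₂ U : LocalField) (f : DiffPoly) :
    curvedCommutator c V₁ V₂ (f • U) =
      ⁅act c V₁, act c V₂⁆ f • U + f • curvedCommutator c V₁ V₂ U := by
  simp only [curvedCommutator, covD_smul, wedge_smul, map_add, Derivation.commutator_apply]
  module

/-- A commutator of metric derivations is metric, and the skew-adjoint wedge term does not disturb
this. -/
theorem commutator_localInner {c : Consts} (hc : c.Admissible) (V₁ V₂ U W : LocalField) :
    ⁅act c V₁, act c V₂⁆ (localInner c U W) =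
      localInner c (curvedCommutator c V₁ V₂ U) W + localInner c U (curvedCommutator c V₁ V₂ W) := by
  simp only [curvedCommutator, Derivation.commutator_apply, act_localInner hc, map_add,
    localInner_add_left, localInner_add_right, localInner_sub_left, localInner_sub_right,
    localInner_smul_left', localInner_smul_right]
  linear_combination -(C c.G) * localInner_wedge c V₁ V₂ U W

theorem curvedCommutator_localInner_self {c : Consts} (hc : c.Admissible) (V₁ V₂ : LocalField)
    {W : LocalField} {r : ℝ} (hW : localInner c W W = C r) :
    localInner c (curvedCommutator c V₁ V₂ W) W = 0 := by
  have h := commutator_localInner hc V₁ V₂ W W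
  rw [hW, derivation_C, localInner_comm c W, ← two_mul] at h
  simpa using h.symm

theorem nabla_fT (c : Consts) : nabla c fT = (C c.a : DiffPoly) • fW₁ := by
  funext j
  fin_cases j <;> simp [nabla_zero, nabla_one, nabla_two, nabla_three, fT, fW₁]

/-- The reparametrization factor of the bracket. -/
noncomputable def commutatorRate (c : Consts) (V₁ V₂ : LocalField) : DiffPoly :=
  act c V₁ (rate c V₂) - act c V₂ (rate c V₁)

/-! ### The bracket: causal character and reparametrization factor -/

section

variable {c : Consts} (hc : c.Admissible) {V₁ V₂ : LocalField}
  (h₁ : V₁ ∈ causalFields c) (h₂ : V₂ ∈ causalFields c)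
include hc h₁ h₂

/-- This is the torsion law for the curved commutator. Products of a factor with D T are symmetric
in the two fields and cancel; the wedge terms combine by the algebraic Bianchi identity. -/
theorem nabla_bracket :
    nabla c (bracket c V₁ V₂) =
      curvedCommutator c V₁ V₂ fT - commutatorRate c V₁ V₂ • fT := by
  have e₁ : nabla c (covD c V₁ V₂) = covD c V₁ (nabla c V₂) - rate c V₁ • nabla c V₂
      + (C c.G : DiffPoly) • wedge c V₁ fT V₂ := by rw [covD_nabla hc h₁]; module
  have e₂ : nabla c (covD c V₂ V₁) = covD c V₂ (nabla c V₁) - rate c V₂ • nabla c V₁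
      + (C c.G : DiffPoly) • wedge c V₂ fT V₁ := by rw [covD_nabla hc h₂]; module
  have n₁ : nabla c V₁ = covD c V₁ fT - rate c V₁ • fT := by rw [covD_fT hc h₁]; module
  have n₂ : nabla c V₂ = covD c V₂ fT - rate c V₂ • fT := by rw [covD_fT hc h₂]; module
  rw [bracket, map_sub, e₁, e₂, n₁, n₂]
  simp only [curvedCommutator, commutatorRate, wedge, map_sub, covD_smul, localInner_comm c fT,
    localInner_comm c V₂ V₁]
  module

/-- Differentiating the wedge terms of `covD_nabla` produces the wedge of the bracket with T and,
through D_V T, wedges with ∇_T V₁ and ∇_T V₂. The latter are what ∇_T of the added wedge of V₁, V₂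
requires. -/
theorem curvedCommutator_nabla (U : LocalField) :
    curvedCommutator c V₁ V₂ (nabla c U) =
      nabla c (curvedCommutator c V₁ V₂ U) + commutatorRate c V₁ V₂ • nabla c U
        - (C c.G : DiffPoly) • wedge c (bracket c V₁ V₂) fT U := by
  simp only [curvedCommutator, commutatorRate, covD_nabla hc h₁, covD_nabla hc h₂, map_sub,
    map_add, covD_smul, derivation_C, nabla_C_smul, covD_wedge hc, nabla_wedge hc, bracket,
    covD_fT hc h₁, covD_fT hc h₂]
  simp only [wedge, localInner_sub_right, localInner_add_right, localInner_smul_right]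
  module

theorem bracket_mem : bracket c V₁ V₂ ∈ causalFields c := by
  have hT : localInner c fT fT = C 0 := by simp [localInner_apply, fT]
  have h := curvedCommutator_localInner_self hc V₁ V₂ hT
  change localInner c (nabla c (bracket c V₁ V₂)) fT = 0
  rw [nabla_bracket hc h₁ h₂, localInner_sub_left, h, localInner_smul_left', hT]
  simp

theorem rate_bracket : rate c (bracket c V₁ V₂) = commutatorRate c V₁ V₂ := by
  have hW : localInner c fW₁ fW₁ = C c.ε₁ := by simp [localInner_apply, fW₁]
  have h := curvedCommutator_localInner_self hc V₁ V₂ hW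
  have h1 := curvedCommutator_nabla hc h₁ h₂ fT
  have h2 := nabla_bracket hc h₁ h₂
  have h3 : curvedCommutator c V₁ V₂ (nabla c fT) =
      (C c.a : DiffPoly) • curvedCommutator c V₁ V₂ fW₁ := by
    rw [nabla_fT, curvedCommutator_smul, derivation_C, zero_smul, zero_add]
  -- The factor 2 has two sources: commuting with ∇_T, and differentiating the multiple of T in
  -- `nabla_bracket`. Paired with W₁, only this term survives.
  have h4 : nabla c (nabla c (bracket c V₁ V₂)) =
      (C c.a : DiffPoly) • curvedCommutator c V₁ V₂ fW₁
        - (2 * commutatorRate c V₁ V₂) • nabla c fT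
        + (C c.G : DiffPoly) • wedge c (bracket c V₁ V₂) fT fT
        - total (commutatorRate c V₁ V₂) • fT := by
    rw [h2, map_sub, nabla_smul, ← h3, h1]; module
  have hTW : localInner c fT fW₁ = 0 := by simp [localInner_apply, fT, fW₁]
  have hTT : localInner c fT fT = 0 := by simp [localInner_apply, fT]
  rw [rate, rho, h4, nabla_fT, C_inv_two_mul]
  simp only [localInner_sub_left, localInner_add_left, localInner_smul_left', h, hW, hTW, wedge,
    hTT]
  linear_combination commutatorRate c V₁ V₂ * (2 * C (1 / 2) * (C c.a * C (1 / c.a)) * C_sq hc.sq₁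
    + 2 * C (1 / 2) * C_mul_inv hc.a_ne + two_mul_C_half)

end

/-! ### Rigidity: T generates the frame and the curvatures -/

/-- A tensor derivation that preserves the metric, commutes with `∇_T` and annihilates `T`
is zero. -/
theorem eq_zero_of_commute_nabla {c : Consts} (hc : c.Admissible)
    (e : Derivation ℝ DiffPoly DiffPoly) (F : LocalField → LocalField)
    (hadd : ∀ U W, F (U + W) = F U + F W) (hsmul : ∀ (f : DiffPoly) U, F (f • U) = e f • U + f • F U)
    (hinner : ∀ U W, e (localInner c U W) = localInner c (F U) W + localInner c U (F W))
    (hnabla : ∀ U, F (nabla c U) = nabla c (F U)) (hT : F fT = 0) :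
    e = 0 ∧ ∀ U, F U = 0 := by
  have ha := C_mul_inv hc.a_ne
  have h1 := C_sq hc.sq₁
  have h2 := C_sq hc.sq₂
  have hCs : ∀ (r : ℝ) U, F ((C r : DiffPoly) • U) = (C r : DiffPoly) • F U := fun r U => by
    rw [hsmul, derivation_C, zero_smul, zero_add]
  have hW1 : F fW₁ = 0 := by
    have h := hnabla fT
    rw [hT, map_zero, nabla_fT, hCs] at h
    have := congrArg (fun Y => (C (1 / c.a) : DiffPoly) • Y) h
    simpa [-one_div, smul_smul, mul_comm, ha] using this
  have hself : ∀ W r, localInner c W W = C r → localInner c (F W) W = 0 := fun W r hW => by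
    have h := hinner W W
    rw [hW, derivation_C, localInner_comm c W, ← two_mul] at h
    simpa using h.symm
  -- Constant products force F W to be orthogonal to every frame vector already killed by F.
  have hort : ∀ W Y r, localInner c W Y = C r → F Y = 0 → localInner c (F W) Y = 0 :=
    fun W Y r hW hY => by
      have h := hinner W Y
      rw [hW, derivation_C, hY] at h
      simpa [localInner_apply] using h.symm
  have nW1 : nabla c fW₁ = (-k₁) • fT + (C (c.a * c.ε₁) : DiffPoly) • fN := by
    funext j
    fin_cases j <;>
      simp [nabla_zero, nabla_one, nabla_two, nabla_three, fT, fW₁, fN]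
  have nN : nabla c fN = (C (-c.ε₁) : DiffPoly) • k₁ • fW₁ + (C c.ε₂ : DiffPoly) • k₂ • fW₂ := by
    funext j
    fin_cases j <;>
      simp [nabla_zero, nabla_one, nabla_two, nabla_three, fW₁, fN, fW₂]
  have hN0 : F fN 2 = 0 := by
    simpa [localInner_apply, fT] using
      hort fN fT (-1) (by simp [localInner_apply, fN, fT]) hT
  have hN2 : F fN 0 = 0 := by
    simpa [localInner_apply, fN] using
      hself fN 0 (by simp [localInner_apply, fN])
  have e1 := hnabla fW₁
  rw [nW1, hW1, map_zero, hadd, hCs, hsmul, hT] at e1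
  -- In F(∇_T W₁) = 0 the T-component isolates e(k₁), since F N has no T-component because ⟨N,N⟩ is
  -- constant. What remains is a ε₁ F N = 0.
  have hk1 : e k₁ = 0 := by
    simpa [fT, hN2] using congrFun e1 0
  have hN : F fN = 0 := by
    rw [map_neg, hk1] at e1
    have := congrArg (fun Y => (C (1 / c.a) * C c.ε₁ : DiffPoly) • Y) e1
    have u : (C (1 / c.a) * C c.ε₁ * C (c.a * c.ε₁) : DiffPoly) = 1 := by
      rw [C.map_mul]; linear_combination (C c.ε₁ * C c.ε₁) * ha + h1
    simpa only [neg_zero, zero_smul, smul_zero, zero_add, smul_smul, u, one_smul] using this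
  have hW2 : F fW₂ = 0 := by
    have t0 : F fW₂ 2 = 0 := by
      simpa [localInner_apply, fT] using
        hort fW₂ fT 0 (by simp [localInner_apply, fW₂, fT]) hT
    have t1 : F fW₂ 0 = 0 := by
      simpa [localInner_apply, fN] using
        hort fW₂ fN 0 (by simp [localInner_apply, fW₂, fN]) hN
    have t2 : C c.ε₁ * F fW₂ 1 = 0 := by
      simpa [localInner_apply, fW₁, -mul_eq_zero] using
        hort fW₂ fW₁ 0 (by simp [localInner_apply, fW₂, fW₁]) hW1
    have t3 : C c.ε₂ * F fW₂ 3 = 0 := by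
      simpa [localInner_apply, fW₂, -mul_eq_zero] using
        hself fW₂ c.ε₂ (by simp [localInner_apply, fW₂])
    funext j
    fin_cases j
    · exact t1
    · change F fW₂ 1 = 0
      linear_combination C c.ε₁ * t2 - F fW₂ 1 * h1
    · exact t0
    · change F fW₂ 3 = 0
      linear_combination C c.ε₂ * t3 - F fW₂ 3 * h2
  have hk2 : e k₂ = 0 := by
    have e2 := hnabla fN
    rw [nN, hN, map_zero, hadd, hCs, hCs, hsmul, hsmul, hW1, hW2, hk1] at e2
    have : C c.ε₂ * e k₂ = 0 := by
      simpa [fW₂, -mul_eq_zero] using congrFun e2 3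
    linear_combination C c.ε₂ * this - e k₂ * h2
  -- The T-component of the commutation law applied to f T, as ∇_T T has none.
  have htotal : ∀ f, e (total f) = total (e f) := fun f => by
    have h := hnabla (f • fT)
    rw [nabla_smul, hadd, hsmul, hsmul, hnabla, hsmul, hT, map_add, nabla_smul] at h
    simpa [fT] using congrFun h 0
  have he : e = 0 := by
    refine MvPolynomial.derivation_ext fun p => ?_
    obtain ⟨i, m⟩ := p
    induction m with
    | zero => fin_cases i <;> [exact hk1; exact hk2]
    | succ m ih =>
      have : (X (i, m + 1) : DiffPoly) = total (X (i, m)) := by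
        simp [total, MvPolynomial.mkDerivation_X]
      rw [this, htotal, ih]; simp
  refine ⟨he, fun U => ?_⟩
  have : U = U 0 • fT + U 1 • fW₁ + U 2 • fN + U 3 • fW₂ := by
    funext j
    fin_cases j <;> simp [fT, fW₁, fN, fW₂]
  rw [this]
  simp [hadd, hsmul, hT, hW1, hN, hW2, he]

/-! ### Commutator rule, curvature identity, Jacobi identity and the subalgebra -/

section

variable {c : Consts} (hc : c.Admissible) {V₁ V₂ : LocalField}
  (h₁ : V₁ ∈ causalFields c) (h₂ : V₂ ∈ causalFields c)
include hc h₁ h₂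

theorem act_and_covD_bracket :
    act c (bracket c V₁ V₂) - ⁅act c V₁, act c V₂⁆ = 0 ∧
      ∀ U, covD c (bracket c V₁ V₂) U - curvedCommutator c V₁ V₂ U = 0 := by
  have h := bracket_mem hc h₁ h₂
  refine eq_zero_of_commute_nabla hc _
    (fun U => covD c (bracket c V₁ V₂) U - curvedCommutator c V₁ V₂ U) ?_ ?_ ?_ ?_ ?_
  · intro U W
    simp only [map_add, curvedCommutator_add]; module
  · intro f U
    simp only [covD_smul, curvedCommutator_smul, Derivation.sub_apply]; module
  · intro U W
    simp only [Derivation.sub_apply, commutator_localInner hc, act_localInner hc,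
      localInner_sub_left, localInner_sub_right]
    ring
  · intro U
    simp only [covD_nabla hc h, curvedCommutator_nabla hc h₁ h₂, map_sub,
      rate_bracket hc h₁ h₂]
    module
  · simp only [covD_fT hc h, nabla_bracket hc h₁ h₂, rate_bracket hc h₁ h₂]
    module

theorem act_bracket (f : DiffPoly) :
    act c (bracket c V₁ V₂) f = act c V₁ (act c V₂ f) - act c V₂ (act c V₁ f) := by
  rw [sub_eq_zero.1 (act_and_covD_bracket hc h₁ h₂).1, Derivation.commutator_apply]

theorem covD_bracket (U : LocalField) :
    covD c (bracket c V₁ V₂) U = covD c V₁ (covD c V₂ U) - covD c V₂ (covD c V₁ U)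
      + (C c.G : DiffPoly) • wedge c V₁ V₂ U :=
  sub_eq_zero.1 ((act_and_covD_bracket hc h₁ h₂).2 U)

end

theorem bracket_jacobi {c : Consts} (hc : c.Admissible) {V₁ V₂ V₃ : LocalField}
    (h₁ : V₁ ∈ causalFields c) (h₂ : V₂ ∈ causalFields c) (h₃ : V₃ ∈ causalFields c) :
    bracket c (bracket c V₁ V₂) V₃ + bracket c (bracket c V₂ V₃) V₁
      + bracket c (bracket c V₃ V₁) V₂ = 0 := by
  have e (V W U : LocalField) (hV : V ∈ causalFields c) (hW : W ∈ causalFields c) :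
      bracket c (bracket c V W) U = covD c V (covD c W U) - covD c W (covD c V U)
        + (C c.G : DiffPoly) • wedge c V W U - (covD c U (covD c V W) - covD c U (covD c W V)) := by
    rw [bracket, covD_bracket hc hV hW, bracket, map_sub]
  -- In the cyclic sum the iterated derivatives cancel in pairs; the wedge terms cancel by symmetry
  -- of the product.
  rw [e _ _ _ h₁ h₂, e _ _ _ h₂ h₃, e _ _ _ h₃ h₁]
  simp only [wedge, localInner_comm c V₃, localInner_comm c V₂ V₁]
  module

theorem mem_arcLengthFields {c : Consts} (hc : c.Admissible) {V : LocalField} :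
    V ∈ arcLengthFields c ↔ V ∈ causalFields c ∧ rate c V = 0 := by
  have hε : (C c.ε₁ : DiffPoly) ≠ 0 := fun h => by simpa [h] using C_sq hc.sq₁
  have hi : (C (1 / (2 * c.a)) : DiffPoly) ≠ 0 := by simpa using hc.a_ne
  change _ ∧ _ ↔ localInner c _ _ = 0 ∧ _
  rw [rate, rho, mul_eq_zero, or_iff_right hi, neg_eq_zero, mul_eq_zero, or_iff_right hε]

theorem bracket_mem_arcLengthFields {c : Consts} (hc : c.Admissible) {V U : LocalField}
    (hV : V ∈ arcLengthFields c) (hU : U ∈ arcLengthFields c) :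
    bracket c V U ∈ arcLengthFields c := by
  rw [mem_arcLengthFields hc] at *
  refine ⟨bracket_mem hc hV.1 hU.1, ?_⟩
  rw [rate_bracket hc hV.1 hU.1, commutatorRate, hV.2, hU.2, map_zero, map_zero, sub_zero]

/-! ### Linearity in the direction, existence and uniqueness -/

section Linear

variable {c : Consts} (r : ℝ) (V W : LocalField)

theorem phi_smul_add : phi c (r • V + W) = C r * phi c V + phi c W := by
  simp only [phi, map_add, map_smul, localInner_add_left, localInner_smul_left,
    MvPolynomial.smul_eq_C_mul]
  ring

theorem psi_smul_add : psi c (r • V + W) = C r * psi c V + psi c W := by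
  simp only [psi, map_add, map_smul, localInner_add_left, localInner_smul_left,
    MvPolynomial.smul_eq_C_mul]
  ring

theorem rho_smul_add : rho c (r • V + W) = C r * rho c V + rho c W := by
  simp only [rho, map_add, map_smul, localInner_add_left, localInner_smul_left,
    MvPolynomial.smul_eq_C_mul]
  ring

theorem alpha_smul_add : alpha c (r • V + W) = C r * alpha c V + alpha c W := by
  simp only [alpha, phi_smul_add, rho_smul_add, map_add, derivation_C_mul]
  ring

theorem beta_smul_add : beta c (r • V + W) = C r * beta c V + beta c W := by
  simp only [beta, phi_smul_add, psi_smul_add, alpha_smul_add, map_add, derivation_C_mul,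
    Pi.add_apply, Pi.smul_apply, MvPolynomial.smul_eq_C_mul]
  ring

theorem delta_smul_add : delta c (r • V + W) = C r * delta c V + delta c W := by
  simp only [delta, phi_smul_add, psi_smul_add, map_add, derivation_C_mul]
  ring

theorem varJet_smul_add (i : Fin 2) (m : ℕ) :
    varJet c (r • V + W) i m = C r * varJet c V i m + varJet c W i m := by
  induction m with
  | zero =>
    fin_cases i <;>
    simp only [varJet, varK₁, varK₂, phi_smul_add, psi_smul_add, rho_smul_add, map_add,
      Derivation.leibniz, smul_eq_mul, derivation_C,
      Pi.add_apply, Pi.smul_apply, MvPolynomial.smul_eq_C_mul] <;>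
    simp <;> ring
  | succ m ih =>
    simp only [varJet, ih, rho_smul_add, map_add, derivation_C_mul]
    ring

theorem act_smul_add : act c (r • V + W) = r • act c V + act c W := by
  refine MvPolynomial.derivation_ext fun p => ?_
  simp [act, MvPolynomial.mkDerivation_X, varJet_smul_add, MvPolynomial.smul_eq_C_mul]

theorem covD_smul_add (U : LocalField) : covD c (r • V + W) U = r • covD c V U + covD c W U := by
  funext j
  fin_cases j <;>
  simp [covD_zero, covD_one, covD_two, covD_three, act_smul_add, phi_smul_add, psi_smul_add,
    alpha_smul_add, beta_smul_add, delta_smul_add, MvPolynomial.smul_eq_C_mul] <;>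
  ring

end Linear

theorem isVariationDerivation_covD (c : Consts) (V : LocalField) :
    IsVariationDerivation c V (act c V) (covD c V) where
  leibniz f U := covD_smul c V U f
  map_total := act_total c V
  map_k₁ := act_k₁ c V
  map_k₂ := act_k₂ c V
  map_T := by funext j; simp [covD_apply, fT, Pi.single_apply, apply_ite]
  map_W₁ := by funext j; simp [covD_apply, fW₁, Pi.single_apply, apply_ite]
  map_N := by funext j; simp [covD_apply, fN, Pi.single_apply, apply_ite]
  map_W₂ := by funext j; simp [covD_apply, fW₂, Pi.single_apply, apply_ite]

/-- The rule for d(f') propagates the values on k₁, k₂ to all jets, and the Leibniz rule propagates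
the values on the frame to all fields. -/
theorem IsVariationDerivation.unique {c : Consts} {V : LocalField}
    {d d' : Derivation ℝ DiffPoly DiffPoly} {D D' : LocalField →ₗ[ℝ] LocalField}
    (h : IsVariationDerivation c V d D) (h' : IsVariationDerivation c V d' D') :
    d = d' ∧ D = D' := by
  have hd : d = d' := by
    refine MvPolynomial.derivation_ext fun p => ?_
    obtain ⟨i, m⟩ := p
    induction m with
    | zero =>
      fin_cases i
      · exact h.map_k₁.trans h'.map_k₁.symm
      · exact h.map_k₂.trans h'.map_k₂.symm
    | succ m ih =>
      have : (X (i, m + 1) : DiffPoly) = total (X (i, m)) := by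
        simp [total, MvPolynomial.mkDerivation_X]
      rw [this, h.map_total, h'.map_total, ih]
  refine ⟨hd, LinearMap.ext fun U => ?_⟩
  have : U = U 0 • fT + U 1 • fW₁ + U 2 • fN + U 3 • fW₂ := by
    funext j
    fin_cases j <;> simp [fT, fW₁, fN, fW₂]
  rw [this]
  simp only [map_add, h.leibniz, h'.leibniz, h.map_T, h'.map_T, h.map_W₁, h'.map_W₁, h.map_N,
    h'.map_N, h.map_W₂, h'.map_W₂, hd]

/-! ### Evaluation along the curve -/

section Along

variable {M : Type*} [TopologicalSpace M] [ChartedSpace E4 M] [IsManifold 𝓘(ℝ, E4) ∞ M]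
  {g : SemiRiemannianMetric M}
  {cov : CovariantDerivative 𝓘(ℝ, E4) E4 (TangentSpace 𝓘(ℝ, E4) : M → Type _)} {a : ℝ}

theorem IsCovDerivAlong.add {γ : ℝ → M} {J : Set ℝ}
    {V V' W W' : Π s : ℝ, TangentSpace 𝓘(ℝ, E4) (γ s)}
    (hV : IsCovDerivAlong cov γ J V V') (hW : IsCovDerivAlong cov γ J W W') :
    IsCovDerivAlong cov γ J (fun s => V s + W s) (fun s => V' s + W' s) := by
  intro s hs
  obtain ⟨n, E, v, hE, hv, h, h'⟩ := hV s hs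
  obtain ⟨m, F, w, hF, hw, e, e'⟩ := hW s hs
  refine ⟨n + m, Fin.append E F, Fin.append v w, ?_, ?_, ?_, ?_⟩
  · refine Fin.addCases (fun i => ?_) (fun i => ?_)
    · simpa only [Fin.append_left] using hE i
    · simpa only [Fin.append_right] using hF i
  · refine Fin.addCases (fun i => ?_) (fun i => ?_)
    · simpa only [Fin.append_left] using hv i
    · simpa only [Fin.append_right] using hw i
  · filter_upwards [h, e] with t ht et
    simp only [ht, et, Fin.sum_univ_add, Fin.append_left, Fin.append_right]
  · simp only [h', e', Fin.sum_univ_add, Fin.append_left, Fin.append_right]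

theorem IsCovDerivAlong.congr_right {γ : ℝ → M} {J : Set ℝ}
    {V V' V'' : Π s : ℝ, TangentSpace 𝓘(ℝ, E4) (γ s)} (hV : IsCovDerivAlong cov γ J V V')
    (h : ∀ s, V' s = V'' s) : IsCovDerivAlong cov γ J V V'' :=
  funext h ▸ hV

/-- The function is absorbed into the coefficients of a local representation. -/
theorem IsCovDerivAlong.smul {γ : ℝ → M} {J : Set ℝ}
    {V V' : Π s : ℝ, TangentSpace 𝓘(ℝ, E4) (γ s)} (hV : IsCovDerivAlong cov γ J V V')
    {f f' : ℝ → ℝ} (hf : ∀ s ∈ J, ContDiffAt ℝ ∞ f s) (hf' : ∀ s ∈ J, HasDerivAt f (f' s) s) :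
    IsCovDerivAlong cov γ J (fun s => f s • V s) (fun s => f' s • V s + f s • V' s) := by
  intro s hs
  obtain ⟨n, E, v, hE, hv, h, h'⟩ := hV s hs
  refine ⟨n, E, fun i t => f t * v i t, hE, fun i => (hf s hs).mul (hv i), ?_, ?_⟩
  · filter_upwards [h] with t ht
    simp only [ht, Finset.smul_sum, mul_smul]
  · have hd : ∀ i, deriv (fun t => f t * v i t) s = f' s * v i s + f s * deriv (v i) s := fun i =>
      ((hf' s hs).mul ((hv i).differentiableAt (by simp)).hasDerivAt).deriv
    simp only [h', h.self_of_nhds, hd, Finset.smul_sum, ← Finset.sum_add_distrib]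
    refine Finset.sum_congr rfl fun i _ => ?_
    module

namespace CartanCurve

variable (γ : CartanCurve g cov a)

theorem value_add (f h : DiffPoly) (s : ℝ) : γ.value (f + h) s = γ.value f s + γ.value h s :=
  map_add _ _ _

theorem value_neg (f : DiffPoly) (s : ℝ) : γ.value (-f) s = -γ.value f s :=
  map_neg _ _

theorem value_sub (f h : DiffPoly) (s : ℝ) : γ.value (f - h) s = γ.value f s - γ.value h s :=
  map_sub _ _ _

theorem value_mul (f h : DiffPoly) (s : ℝ) : γ.value (f * h) s = γ.value f s * γ.value h s :=
  map_mul _ _ _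

theorem value_C (r : ℝ) (s : ℝ) : γ.value (C r) s = r := MvPolynomial.eval_C r

theorem value_X (p : Fin 2 × ℕ) (s : ℝ) : γ.value (X p) s = iteratedDeriv p.2 (γ.k p.1) s :=
  MvPolynomial.eval_X p

theorem contDiffAt_k (i : Fin 2) {s : ℝ} (hs : s ∈ γ.dom) : ContDiffAt ℝ ∞ (γ.k i) s :=
  (γ.smooth_k i).contDiffAt (γ.isOpen_dom.mem_nhds hs)

/-- The curvatures are arbitrary off the interval; since it is open, unrestricted iterated
derivatives at its points are still the right ones. -/
theorem contDiffAt_iteratedDeriv_k (i : Fin 2) (m : ℕ) {s : ℝ} (hs : s ∈ γ.dom) :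
    ContDiffAt ℝ ∞ (iteratedDeriv m (γ.k i)) s := by
  induction m with
  | zero => simpa using γ.contDiffAt_k i hs
  | succ m ih =>
    rw [iteratedDeriv_succ]
    exact ih.derivWithin (by simp)

theorem contDiffAt_value (f : DiffPoly) {s : ℝ} (hs : s ∈ γ.dom) :
    ContDiffAt ℝ ∞ (γ.value f) s := by
  induction f using MvPolynomial.induction_on with
  | C r => simpa only [funext (γ.value_C r)] using contDiffAt_const
  | add p q hp hq => simpa only [funext (γ.value_add p q)] using hp.add hq
  | mul_X p n hp =>
    simpa only [funext (γ.value_mul p _), γ.value_X] using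
      hp.mul (γ.contDiffAt_iteratedDeriv_k n.1 n.2 hs)

theorem hasDerivAt_value (f : DiffPoly) {s : ℝ} (hs : s ∈ γ.dom) :
    HasDerivAt (γ.value f) (γ.value (total f) s) s := by
  induction f using MvPolynomial.induction_on with
  | C r => simpa [funext (γ.value_C r), value] using hasDerivAt_const s r
  | add p q hp hq =>
    rw [map_add, value_add, funext (γ.value_add p q)]
    exact hp.add hq
  | mul_X p n hp =>
    have h : HasDerivAt (iteratedDeriv n.2 (γ.k n.1)) (iteratedDeriv (n.2 + 1) (γ.k n.1) s) s := by
      rw [iteratedDeriv_succ]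
      exact ((γ.contDiffAt_iteratedDeriv_k n.1 n.2 hs).differentiableAt (by simp)).hasDerivAt
    have ht : total (X n) = X (n.1, n.2 + 1) := by simp [total, MvPolynomial.mkDerivation_X]
    have := hp.mul h
    rw [Derivation.leibniz, ht]
    simp only [smul_eq_mul, γ.value_add, γ.value_mul, γ.value_X, funext (γ.value_mul p _)]
    refine this.congr_deriv ?_
    ring

theorem isCovDerivAlong_field (G : ℝ) (V : LocalField) :
    IsCovDerivAlong cov γ.curve γ.dom (γ.field V) (γ.field (nabla (γ.consts G) V)) := by
  have hs (j : Fin 4) : ∀ s ∈ γ.dom, ContDiffAt ℝ ∞ (γ.value (V j)) s :=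
    fun _ => γ.contDiffAt_value _
  have hd (j : Fin 4) : ∀ s ∈ γ.dom, HasDerivAt (γ.value (V j)) (γ.value (total (V j)) s) s :=
    fun _ => γ.hasDerivAt_value _
  have h := (((γ.cartan_T.smul (hs 0) (hd 0)).add (γ.cartan_W₁.smul (hs 1) (hd 1))).add
    (γ.cartan_N.smul (hs 2) (hd 2))).add (γ.cartan_W₂.smul (hs 3) (hd 3))
  refine h.congr_right fun s => ?_
  simp only [field, nabla_zero, nabla_one, nabla_two, nabla_three, value_add, value_sub, value_mul,
    value_C, k₁, k₂, value_X, iteratedDeriv_zero, consts]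
  module

theorem form_field (G : ℝ) (U V : LocalField) {s : ℝ} (hs : s ∈ γ.dom) :
    g.form (γ.curve s) (γ.field U s) (γ.field V s) =
      γ.value (localInner (γ.consts G) U V) s := by
  have hT := γ.T_T s hs
  have hN := γ.N_N s hs
  have hTN := γ.T_N s hs
  have hNT := (g.symm _ _ _).trans hTN
  have h1T := γ.W₁_T s hs
  have hT1 := (g.symm _ _ _).trans h1T
  have h1N := γ.W₁_N s hs
  have hN1 := (g.symm _ _ _).trans h1N
  have h2T := γ.W₂_T s hs
  have hT2 := (g.symm _ _ _).trans h2T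
  have h2N := γ.W₂_N s hs
  have hN2 := (g.symm _ _ _).trans h2N
  have h11 := γ.W₁_W₁ s hs
  have h22 := γ.W₂_W₂ s hs
  have h12 := γ.W₁_W₂ s hs
  have h21 := (g.symm _ _ _).trans h12
  simp only [field, map_add, map_smul, add_apply, smul_apply,
    smul_eq_mul, hT, hN, hTN, hNT, h1T, hT1, h1N, hN1, h2T, hT2, h2N, hN2, h11, h22, h12, h21,
    localInner_apply, value_add, value_sub, value_neg, value_mul, value_C, consts]
  ring

theorem admissible_consts (ha : a ≠ 0) (G : ℝ) : (γ.consts G).Admissible where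
  a_ne := ha
  sq₁ := by rcases γ.ε₁_eq with h | h <;> simp [consts, h]
  sq₂ := by rcases γ.ε₂_eq with h | h <;> simp [consts, h]

/-- Pairing with the frame fields recovers each component up to a nonzero constant, as a
differential polynomial determined by its values. -/
theorem field_injective (hγ : ∀ f : DiffPoly, (∀ s ∈ γ.dom, γ.value f s = 0) → f = 0)
    {U V : LocalField} (h : ∀ s ∈ γ.dom, γ.field U s = γ.field V s) : U = V := by
  -- The product does not involve the ambient curvature, so the value 0 is harmless here.
  have key (W : LocalField) :
      localInner (γ.consts 0) U W = localInner (γ.consts 0) V W := by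
    refine sub_eq_zero.1 (hγ _ fun s hs => ?_)
    rw [value_sub, ← γ.form_field 0 U W hs, ← γ.form_field 0 V W hs, h s hs, sub_self]
  have h1 : (C γ.ε₁ : DiffPoly) ≠ 0 := by
    rcases γ.ε₁_eq with h | h <;> simp [h]
  have h2 : (C γ.ε₂ : DiffPoly) ≠ 0 := by
    rcases γ.ε₂_eq with h | h <;> simp [h]
  funext j
  fin_cases j
  · simpa [localInner_apply, fN] using key fN
  · have := key fW₁
    simp [localInner_apply, fW₁, consts, -mul_eq_mul_left_iff] at this
    exact mul_left_cancel₀ h1 this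
  · simpa [localInner_apply, fT] using key fT
  · have := key fW₂
    simp [localInner_apply, fW₂, consts, -mul_eq_mul_left_iff] at this
    exact mul_left_cancel₀ h2 this

end CartanCurve

end Along

end NullCurve

theorem proposition3 {M : Type*} [TopologicalSpace M] [T2Space M] [SecondCountableTopology M]
    [ChartedSpace E4 M] [IsManifold 𝓘(ℝ, E4) ∞ M]
    (g : SemiRiemannianMetric M) (q : ℕ) (hq : q = 1 ∨ q = 2) (hindex : g.HasIndex q)
    (cov : CovariantDerivative 𝓘(ℝ, E4) E4 (TangentSpace 𝓘(ℝ, E4) : M → Type _))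
    (hcov : g.IsLeviCivita cov) (G : ℝ) (hG : g.HasConstantCurvature cov G)
    (a : ℝ) (ha : 0 < a) (γ : CartanCurve g cov a) :
    -- the operations on local vector fields are those of the vector fields along the curve
    (∀ V : LocalField, IsCovDerivAlong cov γ.curve γ.dom (γ.field V)
      (γ.field (nabla (γ.consts G) V))) ∧
    (∀ U V : LocalField, ∀ s ∈ γ.dom, g.form (γ.curve s) (γ.field U s) (γ.field V s) =
      γ.value (localInner (γ.consts G) U V) s) ∧
    ((∀ f : DiffPoly, (∀ s ∈ γ.dom, γ.value f s = 0) → f = 0) →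
      ∀ U V : LocalField, (∀ s ∈ γ.dom, γ.field U s = γ.field V s) → U = V) ∧
    -- the tensor derivation `D_V` exists and is unique
    (∀ V ∈ causalFields (γ.consts G),
      IsVariationDerivation (γ.consts G) V (act (γ.consts G) V) (covD (γ.consts G) V) ∧
      ∀ (d : Derivation ℝ DiffPoly DiffPoly) (D : LocalField →ₗ[ℝ] LocalField),
        IsVariationDerivation (γ.consts G) V d D →
          d = act (γ.consts G) V ∧ D = covD (γ.consts G) V) ∧
    -- (a) the bracket is well defined
    (∀ V₁ ∈ causalFields (γ.consts G), ∀ V₂ ∈ causalFields (γ.consts G),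
      bracket (γ.consts G) V₁ V₂ ∈ causalFields (γ.consts G)) ∧
    -- (b) it acts on differential polynomials as the commutator
    (∀ V₁ ∈ causalFields (γ.consts G), ∀ V₂ ∈ causalFields (γ.consts G), ∀ f : DiffPoly,
      act (γ.consts G) (bracket (γ.consts G) V₁ V₂) f =
        act (γ.consts G) V₁ (act (γ.consts G) V₂ f) -
          act (γ.consts G) V₂ (act (γ.consts G) V₁ f)) ∧
    -- it is bilinear
    (∀ V₁ ∈ causalFields (γ.consts G), ∀ V₂ ∈ causalFields (γ.consts G),
      ∀ U ∈ causalFields (γ.consts G), ∀ r : ℝ,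
      bracket (γ.consts G) (r • V₁ + V₂) U =
        r • bracket (γ.consts G) V₁ U + bracket (γ.consts G) V₂ U ∧
      bracket (γ.consts G) U (r • V₁ + V₂) =
        r • bracket (γ.consts G) U V₁ + bracket (γ.consts G) U V₂) ∧
    -- (c) it is skew-symmetric
    (∀ V₁ ∈ causalFields (γ.consts G), ∀ V₂ ∈ causalFields (γ.consts G),
      bracket (γ.consts G) V₁ V₂ = -bracket (γ.consts G) V₂ V₁) ∧
    -- (d) the curvature identity
    (∀ V₁ ∈ causalFields (γ.consts G), ∀ V₂ ∈ causalFields (γ.consts G), ∀ U : LocalField,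
      covD (γ.consts G) (bracket (γ.consts G) V₁ V₂) U
          - covD (γ.consts G) V₁ (covD (γ.consts G) V₂ U)
          + covD (γ.consts G) V₂ (covD (γ.consts G) V₁ U) =
        G • (localInner (γ.consts G) U V₁ • V₂ -
          localInner (γ.consts G) U V₂ • V₁)) ∧
    -- (e) the Jacobi identity
    (∀ V₁ ∈ causalFields (γ.consts G), ∀ V₂ ∈ causalFields (γ.consts G),
      ∀ V₃ ∈ causalFields (γ.consts G),
      bracket (γ.consts G) (bracket (γ.consts G) V₁ V₂) V₃
        + bracket (γ.consts G) (bracket (γ.consts G) V₂ V₃) V₁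
        + bracket (γ.consts G) (bracket (γ.consts G) V₃ V₁) V₂ = 0) ∧
    -- (f) it is closed on the fields that also preserve the pseudo arc-length parameter
    (∀ V ∈ arcLengthFields (γ.consts G), ∀ U ∈ arcLengthFields (γ.consts G),
      bracket (γ.consts G) V U ∈ arcLengthFields (γ.consts G)) := by
  have hc := γ.admissible_consts ha.ne' G
  refine ⟨γ.isCovDerivAlong_field G, fun U V s hs => γ.form_field G U V hs,
    fun h U V => γ.field_injective h,
    fun V _ => ⟨isVariationDerivation_covD _ V, fun d D h =>
      h.unique (isVariationDerivation_covD _ V)⟩,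
    fun V₁ h₁ V₂ h₂ => bracket_mem hc h₁ h₂,
    fun V₁ h₁ V₂ h₂ => act_bracket hc h₁ h₂,
    fun V₁ _ V₂ _ U _ r => ⟨?_, ?_⟩,
    fun V₁ _ V₂ _ => (neg_sub _ _).symm,
    fun V₁ h₁ V₂ h₂ U => ?_,
    fun V₁ h₁ V₂ h₂ V₃ h₃ => bracket_jacobi hc h₁ h₂ h₃,
    fun V hV U hU => bracket_mem_arcLengthFields hc hV hU⟩
  · simp only [bracket, covD_smul_add, map_add, map_smul]; module
  · simp only [bracket, covD_smul_add, map_add, map_smul]; module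
  -- The statement scales by the real number G, the algebra above by the constant polynomial.
  · have hG' : ∀ W : LocalField, G • W = (MvPolynomial.C G : DiffPoly) • W := fun W => by
      funext j
      simp [MvPolynomial.smul_eq_C_mul]
    rw [covD_bracket hc h₁ h₂, hG']
    simp only [wedge, CartanCurve.consts]
    module
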